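/- Let $n\ge 2$ and let $\mathbb{H}^n$ be the $n$-dimensional hyperbolic space of constant curvature $-1$. Let $\partial_\infty\mathbb{H}^n$ be the set of asymptote classes of unit-speed geodesic rays, give $\mathbb{H}^n\cup\partial_\infty\mathbb{H}^n$ the cone topology, and for $\Omega\subset\mathbb{H}^n$ let the asymptotic boundary $\partial_\infty\Omega$ be the boundary of $\Omega$ in $\mathbb{H}^n\cup\partial_\infty\mathbb{H}^n$ minus its boundary $\partial\Omega$ in $\mathbb{H}^n$. Let $$\lambda_1=\lambda_1(\mathbb{H}^n)=\inf_{0\ne v\in H^1(\mathbb{H}^n)}\frac{\int_{\mathbb{H}^n}|\nabla v|^2}{\int_{\mathbb{H}^n}v^2}.$$ **Theorem.** Let $\Omega\subset\mathbb{H}^n$ be a domain (open connected set) such that $\partial_\infty\Omega=\{p\}$ for a single point $p\in\partial_\infty\mathbb{H}^n$, and let $\lambda\in[0,\lambda_1]$. Then there is no nontrivial bounded $\lambda$-harmonic function of $\Omega$ that vanishes on $\partial\Omega$; that is, there is no bounded $u\in C(\overline\Omega)\cap C^2(\Omega)$, $u\not\equiv 0$ on $\Omega$, with $$-\Delta u=\lambda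 u\ \text{ in }\Omega,\qquad u=0\ \text{ on }\partial\Omega,$$ where $\Delta$ is the Laplace–Beltrami operator of $\mathbb{H}^n$ and $\overline\Omega$, $\partial\Omega$ are the closure and the boundary of $\Omega$ in $\mathbb{H}^n$. -/

import Mathlib

open scoped ContDiff

noncomputable section

namespace HypBall

/-! ### The Poincaré ball -/

/-- The coordinate space of the Poincaré ball. -/
abbrev E (n : ℕ) := EuclideanSpace ℝ (Fin n)

/-- The points of hyperbolic space `ℍⁿ` in the Poincaré ball model. The subspace topology of the
open unit ball is the topology of the hyperbolic metric. -/
abbrev Hyp (n : ℕ) := ↥(Metric.ball (0 : E n) 1)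

/-- The conformal factor `ρ = 2 / (1 - |x|²)` of the hyperbolic metric `g = ρ² ⟨·,·⟩`. -/
def rho {n : ℕ} (x : E n) : ℝ := 2 / (1 - ‖x‖ ^ 2)

/-- The hyperbolic distance, in closed form:
`sinh² (d(x,y)/2) = |x - y|² / ((1 - |x|²) (1 - |y|²))`. -/
def hypDist {n : ℕ} (x y : Hyp n) : ℝ :=
  2 * Real.arsinh (‖(x : E n) - y‖ / Real.sqrt ((1 - ‖(x : E n)‖ ^ 2) * (1 - ‖(y : E n)‖ ^ 2)))

/-- The origin of the ball. -/
def origin (n : ℕ) : Hyp n := ⟨0, by simp⟩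

theorem hypDist_self {n : ℕ} (x : Hyp n) : hypDist x x = 0 := by
  simp [hypDist]

theorem hypDist_comm {n : ℕ} (x y : Hyp n) : hypDist x y = hypDist y x := by
  simp only [hypDist, norm_sub_rev (x : E n) y, mul_comm (1 - ‖(x : E n)‖ ^ 2)]

theorem one_sub_normSq_pos {n : ℕ} (x : Hyp n) : 0 < 1 - ‖(x : E n)‖ ^ 2 := by
  have h : ‖(x : E n)‖ < 1 := mem_ball_zero_iff.1 x.2
  nlinarith [norm_nonneg (x : E n)]

/-- Ptolemy's inequality for `x`, `y`, `z` and the point inverse to `y` in the unit sphere. -/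
theorem ptolemy_aux {n : ℕ} (x y z : E n) :
    ‖x - z‖ * |1 - ‖y‖ ^ 2| ≤
      ‖x - y‖ * Real.sqrt ((1 - ‖y‖ ^ 2) * (1 - ‖z‖ ^ 2) + ‖y - z‖ ^ 2) +
      ‖y - z‖ * Real.sqrt ((1 - ‖x‖ ^ 2) * (1 - ‖y‖ ^ 2) + ‖x - y‖ ^ 2) := by
  by_cases hy : y = 0
  · subst hy
    simpa using norm_sub_le x z
  have hy' : ‖y‖ ≠ 0 := norm_ne_zero_iff.2 hy
  set w : E n := (‖y‖ ^ 2)⁻¹ • y with hw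
  have key : ∀ a : E n, ‖y‖ * ‖a - w‖ =
      Real.sqrt ((1 - ‖a‖ ^ 2) * (1 - ‖y‖ ^ 2) + ‖a - y‖ ^ 2) := by
    intro a
    have e : (1 - ‖a‖ ^ 2) * (1 - ‖y‖ ^ 2) + ‖a - y‖ ^ 2 = (‖y‖ * ‖a - w‖) ^ 2 := by
      rw [mul_pow, norm_sub_sq_real, norm_sub_sq_real, hw, norm_smul, inner_smul_right,
    Real.norm_of_nonneg (by positivity)]
      field_simp
      ring
    rw [e, Real.sqrt_sq (by positivity)]
  have hyw : ‖y‖ * ‖y - w‖ = |1 - ‖y‖ ^ 2| := by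
    rw [key y, sub_self, norm_zero, ← Real.sqrt_sq_eq_abs]
    ring_nf
  have hzw := key z
  rw [norm_sub_rev z y, mul_comm (1 - ‖z‖ ^ 2)] at hzw
  rw [← hyw, ← hzw, ← key x]
  have h := EuclideanGeometry.mul_dist_le_mul_dist_add_mul_dist x y z w
  simp only [dist_eq_norm] at h
  nlinarith [mul_le_mul_of_nonneg_left h (norm_nonneg y)]

theorem hypDist_triangle {n : ℕ} (x y z : Hyp n) :
    hypDist x z ≤ hypDist x y + hypDist y z := by
  have hx := one_sub_normSq_pos x
  have hy := one_sub_normSq_pos y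
  have hz := one_sub_normSq_pos z
  have h := ptolemy_aux (x : E n) y z
  rw [abs_of_pos hy] at h
  simp only [hypDist]
  rw [← mul_add]
  refine mul_le_mul_of_nonneg_left ?_ (by norm_num)
  rw [← Real.sinh_le_sinh, Real.sinh_add, Real.sinh_arsinh, Real.sinh_arsinh, Real.sinh_arsinh,
    Real.cosh_arsinh, Real.cosh_arsinh]
  set a := 1 - ‖(x : E n)‖ ^ 2
  set b := 1 - ‖(y : E n)‖ ^ 2
  set c := 1 - ‖(z : E n)‖ ^ 2
  have e : ∀ s t r : ℝ, 0 < s → 0 < t →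
      Real.sqrt (1 + (r / Real.sqrt (s * t)) ^ 2) =
        Real.sqrt (s * t + r ^ 2) / Real.sqrt (s * t) := by
    intro s t r hs ht
    rw [← Real.sqrt_div' _ (by positivity), div_pow, Real.sq_sqrt (by positivity)]
    congr 1
    field_simp
  rw [e b c _ hy hz, e a b _ hx hy, Real.sqrt_mul hx.le, Real.sqrt_mul hx.le,
    Real.sqrt_mul hy.le]
  have ha' := Real.sqrt_pos.2 hx
  have hb' := Real.sqrt_pos.2 hy
  have hc' := Real.sqrt_pos.2 hz
  have hbb : b = Real.sqrt b * Real.sqrt b := (Real.mul_self_sqrt hy.le).symm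
  have h2 : ‖(x : E n) - z‖ ≤ (‖(x : E n) - y‖ * Real.sqrt (b * c + ‖(y : E n) - z‖ ^ 2) +
      ‖(y : E n) - z‖ * Real.sqrt (a * b + ‖(x : E n) - y‖ ^ 2)) / b := by
    rwa [le_div_iff₀ hy]
  calc ‖(x : E n) - z‖ / (Real.sqrt a * Real.sqrt c)
      ≤ ((‖(x : E n) - y‖ * Real.sqrt (b * c + ‖(y : E n) - z‖ ^ 2) +
      ‖(y : E n) - z‖ * Real.sqrt (a * b + ‖(x : E n) - y‖ ^ 2)) / b) /
        (Real.sqrt a * Real.sqrt c) := by gcongr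
    _ = _ := by
      rw [div_div, div_mul_div_comm, div_mul_div_comm]
      nth_rewrite 3 [hbb]
      field_simp

/-! ### Ideal points, the cone topology and the asymptotic boundary -/

/-- A geodesic ray parametrized by arclength on `[0, ∞)`: an isometric embedding of `[0, ∞)` into
`ℍⁿ`. The values at negative times play no role. -/
structure GeodesicRay (n : ℕ) where
  toFun : ℝ → Hyp n
  isometry : ∀ s t : ℝ, 0 ≤ s → 0 ≤ t → hypDist (toFun s) (toFun t) = |s - t|

/-- Two rays are asymptotic if `d(γ₁(t), γ₂(t))` is bounded for `t ≥ 0`. -/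
def raySetoid (n : ℕ) : Setoid (GeodesicRay n) where
  r γ₁ γ₂ := ∃ C : ℝ, ∀ t : ℝ, 0 ≤ t → hypDist (γ₁.toFun t) (γ₂.toFun t) ≤ C
  iseqv :=
    { refl := fun γ => ⟨0, fun t _ => (hypDist_self _).le⟩
      symm := by
        rintro γ₁ γ₂ ⟨C, hC⟩
        exact ⟨C, fun t ht => by rw [hypDist_comm]; exact hC t ht⟩
      trans := by
        rintro γ₁ γ₂ γ₃ ⟨C, hC⟩ ⟨D, hD⟩
        exact ⟨C + D, fun t ht =>
          (hypDist_triangle _ (γ₂.toFun t) _).trans (add_le_add (hC t ht) (hD t ht))⟩ }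

/-- The ideal boundary `∂_∞ ℍⁿ`: asymptote classes of geodesic rays. -/
def IdealBoundary (n : ℕ) : Type := Quotient (raySetoid n)

/-- The asymptote class of a ray. -/
def GeodesicRay.endpoint {n : ℕ} (γ : GeodesicRay n) : IdealBoundary n :=
  Quotient.mk (raySetoid n) γ

/-- The initial velocity `γ'(0)` of a ray, in the coordinates of the ball. -/
def GeodesicRay.velocity {n : ℕ} (γ : GeodesicRay n) : E n :=
  derivWithin (fun t => (γ.toFun t : E n)) (Set.Ici 0) 0

/-- The compactification `ℍⁿ ∪ ∂_∞ ℍⁿ`. -/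
inductive HypClosure (n : ℕ) : Type
  | inner (x : Hyp n) : HypClosure n
  | ideal (p : IdealBoundary n) : HypClosure n

/-- The part in `ℍⁿ` of the truncated cone `C(o, γ₀, θ, R)` with vertex `o = γ₀(0)`. The metric is
conformal to the Euclidean one, so the angle between initial velocities is the Euclidean angle. -/
def coneInner {n : ℕ} (γ₀ : GeodesicRay n) (θ R : ℝ) : Set (Hyp n) :=
  {x | ∃ γ : GeodesicRay n, γ.toFun 0 = γ₀.toFun 0 ∧
    InnerProductGeometry.angle γ.velocity γ₀.velocity < θ / 2 ∧ ∃ t : ℝ, R < t ∧ γ.toFun t = x}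

/-- The part in `∂_∞ ℍⁿ` of the truncated cone: the endpoints of the rays from the vertex that
stay eventually in the cone. -/
def coneIdeal {n : ℕ} (γ₀ : GeodesicRay n) (θ R : ℝ) : Set (IdealBoundary n) :=
  {p | ∃ γ : GeodesicRay n, γ.toFun 0 = γ₀.toFun 0 ∧
    (∀ᶠ t in Filter.atTop, γ.toFun t ∈ coneInner γ₀ θ R) ∧ γ.endpoint = p}

/-- The truncated cone `C(o, γ₀, θ, R)`. -/
def cone {n : ℕ} (γ₀ : GeodesicRay n) (θ R : ℝ) : Set (HypClosure n) :=
  HypClosure.inner '' coneInner γ₀ θ R ∪ HypClosure.ideal '' coneIdeal γ₀ θ R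

/-- The cone topology on `ℍⁿ ∪ ∂_∞ ℍⁿ`: it is generated by the open sets of `ℍⁿ` and the truncated
cones. The vertex of the cones is fixed at the origin; the topology is the same for any vertex. -/
instance coneTopology (n : ℕ) : TopologicalSpace (HypClosure n) :=
  TopologicalSpace.generateFrom
    ({S | ∃ U : Set (Hyp n), IsOpen U ∧ S = HypClosure.inner '' U} ∪
     {S | ∃ (γ₀ : GeodesicRay n) (θ R : ℝ),
        γ₀.toFun 0 = origin n ∧ 0 < θ ∧ 0 ≤ R ∧ S = cone γ₀ θ R})

/-- The asymptotic boundary `∂_∞ Ω`: the boundary of `Ω` in `ℍⁿ ∪ ∂_∞ ℍⁿ` minus its boundary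
in `ℍⁿ`. -/
def asymptoticBoundary {n : ℕ} (Ω : Set (Hyp n)) : Set (HypClosure n) :=
  frontier (HypClosure.inner '' Ω) \ HypClosure.inner '' frontier Ω

/-! ### The Laplacian and `λ`-harmonic functions -/

/-- A function on `ℍⁿ` in the coordinates of the ball (extended by zero outside the ball). -/
def inCoords {n : ℕ} (u : Hyp n → ℝ) : E n → ℝ := Function.extend Subtype.val u 0

/-- The Laplace–Beltrami operator of `g = ρ² ⟨·,·⟩`, that is `ρ⁻ⁿ div (ρⁿ⁻² ∇u)`, written out:
`Δ_g u = ρ⁻² (Δu + (n - 2) ⟨∇ log ρ, ∇u⟩)` with `∇ log ρ = ρ x`. -/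
def hypLaplacian {n : ℕ} (u : Hyp n → ℝ) (x : Hyp n) : ℝ :=
  (rho (x : E n))⁻¹ ^ 2 * Laplacian.laplacian (inCoords u) (x : E n) +
    ((n : ℝ) - 2) * (rho (x : E n))⁻¹ * fderiv ℝ (inCoords u) (x : E n) (x : E n)

/-- `u` is a `λ`-harmonic function of `Ω`: it is not identically zero on `Ω`, it belongs to
`C(closure Ω) ∩ C²(Ω)`, `-Δu = λ u` in `Ω`, and `u = 0` on `∂Ω`. -/
structure IsLambdaHarmonic {n : ℕ} (lam : ℝ) (Ω : Set (Hyp n)) (u : Hyp n → ℝ) : Prop where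
  nontrivial : ∃ x ∈ Ω, u x ≠ 0
  continuousOn : ContinuousOn u (closure Ω)
  contDiffOn : ContDiffOn ℝ 2 (inCoords u) (Subtype.val '' Ω)
  equation : ∀ x ∈ Ω, -hypLaplacian u x = lam * u x
  boundary : ∀ x ∈ frontier Ω, u x = 0

/-! ### The first eigenvalue -/

/-- The Riemannian volume measure `ρⁿ dx`, as a measure on the coordinate space that is carried by
the unit ball. -/
def hypVolume (n : ℕ) : MeasureTheory.Measure (E n) :=
  (MeasureTheory.volume.restrict (Metric.ball (0 : E n) 1)).withDensity
    fun x => ENNReal.ofReal (rho x ^ n)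

/-- `v` belongs to `H¹(ℍⁿ)` with weak Euclidean gradient `G` in the ball: `v` and
`|∇v|_g = ρ⁻¹ |G|` are square integrable for the Riemannian volume. -/
structure IsH1 {n : ℕ} (v : E n → ℝ) (G : E n → E n) : Prop where
  memLp : MeasureTheory.MemLp v 2 (hypVolume n)
  memLp_grad : MeasureTheory.MemLp (fun x => (rho x)⁻¹ • G x) 2 (hypVolume n)
  weakGrad : ∀ φ : E n → ℝ, ContDiff ℝ ∞ φ → HasCompactSupport φ →
    tsupport φ ⊆ Metric.ball 0 1 → ∀ i : Fin n,
      ∫ x in Metric.ball (0 : E n) 1, v x * fderiv ℝ φ x (EuclideanSpace.single i 1) =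
        -∫ x in Metric.ball (0 : E n) 1, G x i * φ x

/-- The first eigenvalue `λ₁(ℍⁿ)`: the infimum over nonzero `v ∈ H¹(ℍⁿ)` of
`(∫ |∇v|²) / (∫ v²)`. -/
def lambdaOne (n : ℕ) : ℝ :=
  sInf {q : ℝ | ∃ (v : E n → ℝ) (G : E n → E n), IsH1 v G ∧ ¬ v =ᵐ[hypVolume n] 0 ∧
    q = (∫ x, ‖(rho x)⁻¹ • G x‖ ^ 2 ∂hypVolume n) / ∫ x, v x ^ 2 ∂hypVolume n}

end HypBall

end

/-!
Put `a = (n - 1) / 2`. A bounded solution is compared with explicit barriers which live outside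
shrinking hyperbolic half-spaces around the only ideal boundary point of `Ω`.

* `λ₁(ℍⁿ) ≤ a²`, by the test functions `(1 - |x|²)ˢ` with `s > a`, whose Rayleigh quotient is at
  most `s²` (`lambdaOne_le`). Hence `λ ≤ a²`.
* A point of the unit sphere in the Euclidean closure of `Ω` is the endpoint of a radial ray that
  belongs to the asymptotic boundary of `Ω`, and different points give different endpoints. So the
  Euclidean closure of `Ω` meets the unit sphere at most in one point `ζ`
  (`exists_unit_of_asymptoticBoundary_eq_singleton`).
* Let `X = sinh t`, where `t` is the signed distance to a totally geodesic hypersurface that bounds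
  a half-space around `ζ`, negative in this half-space. Then `ΔX = n X` and `|∇X|² = 1 + X²`
  (`ballLaplacian_comp_sinhDist`), and the function `W = F(X)` with `F(X) = X⁻ᵃ - X⁻ᵃ⁻¹` is positive
  and satisfies `ΔW + a² W < 0` where `X ≥ S = a (a + 1) + 1` (`profile_strict_supersolution`).
* The part of `closure Ω` where `X ≥ S` is compact in `ℍⁿ`, so that the quotient `u / W` attains its
  maximum there. If this maximum is positive, it is not attained on `∂Ω`, where `u = 0`, nor inside,
  where it would contradict the strict inequality for `W`; and it is at most `M / F(S)` on `X = S`,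
  if `u ≤ M`. So `u ≤ M W / F(S)` (`IsLambdaHarmonic.le_profile`).
* When the half-space shrinks to `ζ`, at a fixed point `X` tends to infinity and `W` to zero, so
  `u ≤ 0` (`IsLambdaHarmonic.nonpos_of_le`). The same holds for `-u`.
-/

/-! ### The upper bound for the first eigenvalue -/

namespace HypBall

open MeasureTheory Metric Set

variable {n : ℕ}

theorem one_sub_normSq_pos_of_mem_ball {x : E n} (hx : x ∈ ball (0 : E n) 1) :
    0 < 1 - ‖x‖ ^ 2 :=
  one_sub_normSq_pos ⟨x, hx⟩

theorem measurable_rho : Measurable (rho : E n → ℝ) := by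
  unfold rho; fun_prop

theorem ae_hypVolume_mem_ball : ∀ᵐ x ∂hypVolume n, x ∈ ball (0 : E n) 1 :=
  (withDensity_absolutelyContinuous _ _).ae_le (ae_restrict_mem measurableSet_ball)

theorem integrableOn_one_sub_normSq_rpow (hn : 2 ≤ n) {b : ℝ} (hb : -1 < b) :
    IntegrableOn (fun x : E n => (1 - ‖x‖ ^ 2) ^ b) (ball 0 1) := by
  have : Nontrivial (E n) := by
    have : Nonempty (Fin n) := ⟨⟨0, by omega⟩⟩
    infer_instance
  refine (integrableOn_fun_norm_addHaar volume (f := fun y : ℝ => (1 - y ^ 2) ^ b)).2 ?_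
  -- `1 - y² = (1 - y)(1 + y)`, where only the first factor may blow up
  have h1 : IntervalIntegrable (fun y : ℝ => (1 - y) ^ b) volume 0 1 := by
    have := (intervalIntegral.intervalIntegrable_rpow' (a := 1) (b := 0) hb).comp_sub_left 1
    simpa using this
  have h2 : ContinuousOn (fun y : ℝ => y ^ (Module.finrank ℝ (E n) - 1) * (1 + y) ^ b)
      (uIcc 0 1) := by
    refine ContinuousOn.mul (by fun_prop) (ContinuousOn.rpow_const (by fun_prop) ?_)
    intro y hy
    rw [uIcc_of_le zero_le_one] at hy
    left; linarith [hy.1]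
  have h3 := h1.continuousOn_mul h2
  rw [intervalIntegrable_iff_integrableOn_Ioo_of_le zero_le_one] at h3
  refine h3.congr_fun (fun y hy => ?_) measurableSet_Ioo
  have : 1 - y ^ 2 = (1 + y) * (1 - y) := by ring
  simp only [smul_eq_mul]
  rw [this, Real.mul_rpow (by linarith [hy.1]) (by linarith [hy.2])]
  ring

/-- The radial function `(1 - |x|²)ˢ`, comparable to `e^(-s d(0,x))`. It belongs to `H¹(ℍⁿ)` as
soon as `s > (n - 1) / 2`. -/
noncomputable def radialFn (n : ℕ) (s : ℝ) (x : E n) : ℝ := (1 - ‖x‖ ^ 2) ^ s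

/-- The Euclidean gradient of `radialFn n s` in the ball. -/
noncomputable def radialGrad (n : ℕ) (s : ℝ) (x : E n) : E n :=
  (-2 * s * (1 - ‖x‖ ^ 2) ^ (s - 1)) • x

theorem measurable_radialFn (s : ℝ) : Measurable (radialFn n s) := by
  unfold radialFn; fun_prop

theorem measurable_radialGrad (s : ℝ) : Measurable (radialGrad n s) := by
  unfold radialGrad; fun_prop

theorem radialFn_pos (s : ℝ) {x : E n} (hx : x ∈ ball (0 : E n) 1) : 0 < radialFn n s x :=
  Real.rpow_pos_of_pos (one_sub_normSq_pos_of_mem_ball hx) _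

theorem hasFDerivAt_radialFn (s : ℝ) {x : E n} (hx : x ∈ ball (0 : E n) 1) :
    HasFDerivAt (radialFn n s) (innerSL ℝ (radialGrad n s x)) x := by
  have h0 := (one_sub_normSq_pos_of_mem_ball hx).ne'
  have h := ((hasStrictFDerivAt_norm_sq x).hasFDerivAt.const_sub 1).rpow_const
    (p := s) (Or.inl h0)
  refine h.congr_fderiv ?_
  ext y
  simp [radialGrad]
  ring

theorem continuousOn_radialFn (s : ℝ) : ContinuousOn (radialFn n s) (ball 0 1) :=
  fun _ hx => (hasFDerivAt_radialFn s hx).continuousAt.continuousWithinAt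

theorem continuousOn_radialGrad (s : ℝ) : ContinuousOn (radialGrad n s) (ball 0 1) := by
  exact ContinuousOn.smul (continuousOn_const.mul (continuousOn_radialFn (s - 1))) continuousOn_id

theorem integrable_radialFn_sq (hn : 2 ≤ n) {s : ℝ} (hs : ((n : ℝ) - 1) / 2 < s) :
    Integrable (fun x => radialFn n s x ^ 2) (hypVolume n) := by
  unfold hypVolume
  rw [integrable_withDensity_iff_integrable_smul']
  · have := (integrableOn_one_sub_normSq_rpow hn (b := 2 * s - n) (by linarith)).const_mul (2 ^ n)
    refine IntegrableOn.congr_fun this (fun x hx => ?_) measurableSet_ball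
    have h0 := one_sub_normSq_pos_of_mem_ball hx
    rw [ENNReal.toReal_ofReal (by unfold rho; positivity)]
    simp only [radialFn, rho, smul_eq_mul, div_pow]
    rw [Real.rpow_sub h0, mul_comm 2 s, Real.rpow_mul h0.le, Real.rpow_natCast]
    simp
    ring
  · exact (measurable_rho.pow_const n).ennreal_ofReal
  · simp

theorem norm_smul_radialGrad_sq (s : ℝ) {x : E n} (hx : x ∈ ball (0 : E n) 1) :
    ‖(rho x)⁻¹ • radialGrad n s x‖ ^ 2 = s ^ 2 * ‖x‖ ^ 2 * radialFn n s x ^ 2 := by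
  have h0 := one_sub_normSq_pos_of_mem_ball hx
  have : (rho x)⁻¹ * (-2 * s * (1 - ‖x‖ ^ 2) ^ (s - 1)) = -s * radialFn n s x := by
    rw [Real.rpow_sub h0, Real.rpow_one, rho, radialFn]
    field_simp
  rw [radialGrad, smul_smul, this, norm_smul, mul_pow, Real.norm_eq_abs, sq_abs]
  ring

theorem norm_smul_radialGrad_sq_le (s : ℝ) {x : E n} (hx : x ∈ ball (0 : E n) 1) :
    ‖(rho x)⁻¹ • radialGrad n s x‖ ^ 2 ≤ s ^ 2 * radialFn n s x ^ 2 := by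
  rw [norm_smul_radialGrad_sq s hx]
  have h0 := one_sub_normSq_pos_of_mem_ball hx
  have : 0 ≤ s ^ 2 * radialFn n s x ^ 2 := by positivity
  nlinarith

theorem aestronglyMeasurable_smul_radialGrad (s : ℝ) :
    AEStronglyMeasurable (fun x => (rho x)⁻¹ • radialGrad n s x) (hypVolume n) :=
  (measurable_rho.inv.smul (measurable_radialGrad s)).aestronglyMeasurable

theorem integrable_norm_smul_radialGrad_sq (hn : 2 ≤ n) {s : ℝ} (hs : ((n : ℝ) - 1) / 2 < s) :
    Integrable (fun x => ‖(rho x)⁻¹ • radialGrad n s x‖ ^ 2) (hypVolume n) := by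
  refine ((integrable_radialFn_sq hn hs).const_mul (s ^ 2)).mono'
    ((aestronglyMeasurable_smul_radialGrad s).norm.pow 2) ?_
  filter_upwards [ae_hypVolume_mem_ball] with x hx
  rw [Real.norm_of_nonneg (by positivity)]
  exact norm_smul_radialGrad_sq_le s hx

theorem isH1_radialFn (hn : 2 ≤ n) {s : ℝ} (hs : ((n : ℝ) - 1) / 2 < s) :
    IsH1 (radialFn n s) (radialGrad n s) where
  memLp := (memLp_two_iff_integrable_sq (measurable_radialFn s).aestronglyMeasurable).2
    (integrable_radialFn_sq hn hs)
  memLp_grad := (memLp_two_iff_integrable_sq_norm (aestronglyMeasurable_smul_radialGrad s)).2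
    (integrable_norm_smul_radialGrad_sq hn hs)
  weakGrad := by
    intro φ hφ hcs hsub i
    have hdiff : Differentiable ℝ φ := hφ.differentiable (by simp)
    have hts' : tsupport (fun x => fderiv ℝ φ x (EuclideanSpace.single i 1)) ⊆ tsupport φ :=
      tsupport_fderiv_apply_subset ℝ _
    have hcont' : Continuous (fun x => fderiv ℝ φ x (EuclideanSpace.single i 1)) :=
      (hφ.continuous_fderiv (by simp)).clm_apply continuous_const
    have hcs' : HasCompactSupport (fun x => fderiv ℝ φ x (EuclideanSpace.single i 1)) :=
      hcs.fderiv_apply ℝ _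
    -- products with a test function are continuous with compact support
    have hint : ∀ f g : E n → ℝ, ContinuousOn f (ball 0 1) → Continuous g →
        tsupport g ⊆ ball 0 1 → HasCompactSupport g → Integrable (fun x => f x * g x) := by
      intro f g hf hg hgs hgc
      have hc : Continuous (fun x => f x * g x) :=
        continuous_of_tsupport fun x hx =>
          (hf.continuousAt (isOpen_ball.mem_nhds (hgs (tsupport_mul_subset_right hx)))).mul
            hg.continuousAt
      exact hc.integrable_of_hasCompactSupport hgc.mul_left
    have hgrad : ∀ x ∈ ball (0 : E n) 1,
        fderiv ℝ (radialFn n s) x (EuclideanSpace.single i 1) = radialGrad n s x i := by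
      intro x hx
      rw [(hasFDerivAt_radialFn s hx).fderiv, innerSL_apply_apply,
        EuclideanSpace.inner_single_right]
      simp
    have hzero : ∀ x ∉ ball (0 : E n) 1, φ x = 0 := fun x hx =>
      image_eq_zero_of_notMem_tsupport fun h => hx (hsub h)
    have hzero' : ∀ x ∉ ball (0 : E n) 1, fderiv ℝ φ x (EuclideanSpace.single i 1) = 0 :=
      fun x hx => image_eq_zero_of_notMem_tsupport
        (f := fun x => fderiv ℝ φ x (EuclideanSpace.single i 1)) fun h => hx (hsub (hts' h))
    have hcomp : ContinuousOn (fun x => radialGrad n s x i) (ball 0 1) :=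
      (EuclideanSpace.proj (𝕜 := ℝ) i).continuous.comp_continuousOn (continuousOn_radialGrad s)
    have heq : (fun x => fderiv ℝ (radialFn n s) x (EuclideanSpace.single i 1) * φ x) =
        fun x => radialGrad n s x i * φ x := by
      funext x
      by_cases hx : x ∈ ball (0 : E n) 1
      · rw [hgrad x hx]
      · simp [hzero x hx]
    rw [setIntegral_eq_integral_of_forall_compl_eq_zero (fun x hx => by rw [hzero' x hx, mul_zero]),
      setIntegral_eq_integral_of_forall_compl_eq_zero (fun x hx => by rw [hzero x hx, mul_zero]),
      integral_mul_fderiv_eq_neg_fderiv_mul_of_integrable, heq]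
    · rw [heq]
      exact hint _ _ hcomp hφ.continuous hsub hcs
    · exact hint _ _ (continuousOn_radialFn s) hcont' (hts'.trans hsub) hcs'
    · exact hint _ _ (continuousOn_radialFn s) hφ.continuous hsub hcs
    · exact fun x hx => (hasFDerivAt_radialFn s (hsub hx)).differentiableAt
    · exact fun x _ => hdiff x

theorem radialFn_not_ae_zero (s : ℝ) : ¬ radialFn n s =ᵐ[hypVolume n] 0 := by
  intro h
  unfold hypVolume at h
  rw [Filter.EventuallyEq, ae_withDensity_iff (measurable_rho.pow_const n).ennreal_ofReal,
    ae_restrict_iff' measurableSet_ball] at h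
  have h0 : volume (ball (0 : E n) 1) = 0 := by
    refine measure_mono_null (fun x hx => ?_) (ae_iff.1 h)
    simp only [mem_ofPred_eq, Classical.not_imp]
    refine ⟨hx, ?_, (radialFn_pos s hx).ne'⟩
    have h0 := one_sub_normSq_pos_of_mem_ball hx
    simp only [ne_eq, ENNReal.ofReal_eq_zero, not_le]
    unfold rho
    positivity
  exact (measure_ball_pos volume (0 : E n) one_pos).ne' h0

/-- The easy half of McKean's formula `λ₁(ℍⁿ) = (n - 1)² / 4`: since `|∇v|² = s² |x|² v²` for
`v = (1 - |x|²)ˢ`, the Rayleigh quotient of `v` is at most `s²` for every `s > (n - 1) / 2`. -/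
theorem lambdaOne_le (hn : 2 ≤ n) : lambdaOne n ≤ (((n : ℝ) - 1) / 2) ^ 2 := by
  have key : ∀ s : ℝ, ((n : ℝ) - 1) / 2 < s → lambdaOne n ≤ s ^ 2 := by
    intro s hs
    have hle : (∫ x, ‖(rho x)⁻¹ • radialGrad n s x‖ ^ 2 ∂hypVolume n) /
        ∫ x, radialFn n s x ^ 2 ∂hypVolume n ≤ s ^ 2 := by
      refine div_le_of_le_mul₀ (integral_nonneg fun x => by positivity) (by positivity) ?_
      rw [← integral_const_mul]
      refine integral_mono_ae (integrable_norm_smul_radialGrad_sq hn hs)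
        ((integrable_radialFn_sq hn hs).const_mul _) ?_
      filter_upwards [ae_hypVolume_mem_ball] with x hx
      exact norm_smul_radialGrad_sq_le s hx
    unfold lambdaOne
    refine le_trans (csInf_le ⟨0, ?_⟩
      ⟨_, _, isH1_radialFn hn hs, radialFn_not_ae_zero s, rfl⟩) hle
    rintro q ⟨v, G, -, -, rfl⟩
    exact div_nonneg (integral_nonneg fun x => by positivity)
      (integral_nonneg fun x => by positivity)
  refine ge_of_tendsto (x := nhdsWithin (((n : ℝ) - 1) / 2) (Ioi (((n : ℝ) - 1) / 2)))
    (f := fun s : ℝ => s ^ 2)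
    ((continuous_pow 2).continuousAt.mono_left nhdsWithin_le_nhds) ?_
  filter_upwards [self_mem_nhdsWithin] with s hs
  exact key s hs

end HypBall

/-! ### Radial rays and the trace of a domain on the unit sphere -/

namespace HypBall

open Metric Set Filter Topology

variable {n : ℕ}

theorem one_sub_tanh_sq (a : ℝ) : 1 - Real.tanh a ^ 2 = (Real.cosh a ^ 2)⁻¹ := by
  have := Real.cosh_sq_sub_sinh_sq a
  have hc := Real.cosh_pos a
  rw [Real.tanh_eq_sinh_div_cosh, div_pow]
  field_simp
  linarith

theorem tanh_sub_tanh (a b : ℝ) :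
    Real.tanh a - Real.tanh b = Real.sinh (a - b) / (Real.cosh a * Real.cosh b) := by
  have ha := (Real.cosh_pos a).ne'
  have hb := (Real.cosh_pos b).ne'
  rw [Real.sinh_sub, Real.tanh_eq_sinh_div_cosh, Real.tanh_eq_sinh_div_cosh]
  field_simp

theorem tanh_pos_of_pos {a : ℝ} (ha : 0 < a) : 0 < Real.tanh a := by
  rw [Real.tanh_eq_sinh_div_cosh]
  exact div_pos (Real.sinh_pos_iff.2 ha) (Real.cosh_pos a)

theorem tanh_nonneg_of_nonneg {a : ℝ} (ha : 0 ≤ a) : 0 ≤ Real.tanh a := by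
  rw [Real.tanh_eq_sinh_div_cosh]
  exact div_nonneg (Real.sinh_nonneg_iff.2 ha) (Real.cosh_pos a).le

theorem abs_sinh_eq_sinh_abs (a : ℝ) : |Real.sinh a| = Real.sinh |a| := by
  rcases le_total 0 a with h | h
  · rw [abs_of_nonneg h, abs_of_nonneg (Real.sinh_nonneg_iff.2 h)]
  · rw [abs_of_nonpos h, abs_of_nonpos (Real.sinh_nonpos_iff.2 h), Real.sinh_neg]

/-- The hyperbolic distance determines the Euclidean one, once the norms are known. -/
theorem norm_sub_eq_sinh_mul (x y : Hyp n) :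
    ‖(x : E n) - y‖ = Real.sinh (hypDist x y / 2) *
      Real.sqrt ((1 - ‖(x : E n)‖ ^ 2) * (1 - ‖(y : E n)‖ ^ 2)) := by
  have h := Real.sqrt_pos.2 (mul_pos (one_sub_normSq_pos x) (one_sub_normSq_pos y))
  rw [hypDist, mul_div_cancel_left₀ _ two_ne_zero, Real.sinh_arsinh, div_mul_cancel₀ _ h.ne']

theorem norm_sub_eq_of_norm_eq_tanh {x y : Hyp n} {a b : ℝ} (hx : ‖(x : E n)‖ = |Real.tanh a|)
    (hy : ‖(y : E n)‖ = |Real.tanh b|) :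
    ‖(x : E n) - y‖ = Real.sinh (hypDist x y / 2) / (Real.cosh a * Real.cosh b) := by
  have ha := Real.cosh_pos a
  have hb := Real.cosh_pos b
  rw [norm_sub_eq_sinh_mul, hx, hy, sq_abs, sq_abs, one_sub_tanh_sq, one_sub_tanh_sq, ← mul_inv,
    ← mul_pow, ← inv_pow, Real.sqrt_sq (by positivity)]
  rfl

theorem norm_eq_tanh (x : Hyp n) : ‖(x : E n)‖ = Real.tanh (hypDist (origin n) x / 2) := by
  set d := hypDist (origin n) x / 2
  have h0 : 0 < 1 - ‖(x : E n)‖ ^ 2 := one_sub_normSq_pos x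
  have h := norm_sub_eq_sinh_mul (origin n) x
  rw [show ((origin n : Hyp n) : E n) = 0 from rfl, zero_sub, norm_neg, norm_zero,
    zero_pow two_ne_zero, sub_zero, one_mul] at h
  have hd : Real.sinh d = ‖(x : E n)‖ / Real.sqrt (1 - ‖(x : E n)‖ ^ 2) := by
    rw [eq_div_iff (Real.sqrt_pos.2 h0).ne']
    exact h.symm
  have hx1 : ‖(x : E n)‖ ∈ Ioo (-1 : ℝ) 1 :=
    ⟨by linarith [norm_nonneg (x : E n)], mem_ball_zero_iff.1 x.2⟩
  rw [← Real.sinh_artanh hx1] at hd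
  rw [Real.sinh_injective hd, Real.tanh_artanh hx1]

/-- The radial geodesic ray `t ↦ tanh (t / 2) v` with direction a unit vector `v`. -/
noncomputable def radialRay (v : E n) (hv : ‖v‖ = 1) : GeodesicRay n where
  toFun t := ⟨Real.tanh (t / 2) • v, by
    rw [mem_ball_zero_iff, norm_smul, hv, mul_one]; exact Real.abs_tanh_lt_one _⟩
  isometry := by
    intro s t _ _
    set x : Hyp n := ⟨Real.tanh (s / 2) • v, _⟩ with hx
    set y : Hyp n := ⟨Real.tanh (t / 2) • v, _⟩ with hy
    have ha := Real.cosh_pos (s / 2)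
    have hb := Real.cosh_pos (t / 2)
    have h : ‖(x : E n) - y‖ = Real.sinh (hypDist x y / 2) /
        (Real.cosh (s / 2) * Real.cosh (t / 2)) :=
      norm_sub_eq_of_norm_eq_tanh (by simp [hx, norm_smul, hv]) (by simp [hy, norm_smul, hv])
    have h2 : ‖(x : E n) - y‖ = |Real.tanh (s / 2) - Real.tanh (t / 2)| := by
      simp [hx, hy, ← sub_smul, norm_smul, hv]
    rw [h2, tanh_sub_tanh, abs_div, abs_of_pos (mul_pos ha hb), abs_sinh_eq_sinh_abs,
      div_left_inj' (mul_pos ha hb).ne'] at h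
    have h3 := Real.sinh_injective h
    rw [← sub_div, abs_div, abs_two] at h3
    linarith

/-- A ray that starts at the centre of the ball is radial: the distances along the ray are such
that equality holds in the Euclidean reverse triangle inequality. -/
theorem GeodesicRay.exists_direction (γ : GeodesicRay n) (h0 : γ.toFun 0 = origin n) :
    ∃ v : E n, ‖v‖ = 1 ∧ ∀ t : ℝ, 0 ≤ t → (γ.toFun t : E n) = Real.tanh (t / 2) • v := by
  have hnorm : ∀ t : ℝ, 0 ≤ t → ‖(γ.toFun t : E n)‖ = Real.tanh (t / 2) := by
    intro t ht
    rw [norm_eq_tanh, ← h0, γ.isometry 0 t le_rfl ht, zero_sub, abs_neg, abs_of_nonneg ht]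
  have hray : ∀ t : ℝ, 0 ≤ t → SameRay ℝ (γ.toFun t : E n) (γ.toFun 1) := by
    intro t ht
    rw [sameRay_iff_norm_sub, norm_sub_eq_of_norm_eq_tanh (a := t / 2) (b := 1 / 2),
      γ.isometry t 1 ht zero_le_one, hnorm t ht, hnorm 1 zero_le_one, tanh_sub_tanh, abs_div,
      abs_sinh_eq_sinh_abs, ← sub_div, abs_div, abs_two,
      abs_of_pos (mul_pos (Real.cosh_pos _) (Real.cosh_pos _))]
    · rw [hnorm t ht, abs_of_nonneg (tanh_nonneg_of_nonneg (by linarith))]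
    · rw [hnorm 1 zero_le_one, abs_of_nonneg (tanh_nonneg_of_nonneg (by norm_num))]
  have hpos : 0 < Real.tanh (1 / 2) := tanh_pos_of_pos (by norm_num)
  refine ⟨(Real.tanh (1 / 2))⁻¹ • (γ.toFun 1 : E n), ?_, fun t ht => ?_⟩
  · rw [norm_smul, hnorm 1 zero_le_one, norm_inv, Real.norm_of_nonneg hpos.le,
      inv_mul_cancel₀ hpos.ne']
  · have h := (hray t ht).norm_smul_eq
    rw [hnorm t ht, hnorm 1 zero_le_one] at h
    rw [smul_comm, h, smul_smul, inv_mul_cancel₀ hpos.ne', one_smul]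

theorem GeodesicRay.velocity_eq {γ : GeodesicRay n} {v : E n}
    (h : ∀ t : ℝ, 0 ≤ t → (γ.toFun t : E n) = Real.tanh (t / 2) • v) :
    γ.velocity = (1 / 2 : ℝ) • v := by
  have h1 : HasDerivAt (fun t : ℝ => Real.tanh (t / 2)) (1 / 2) 0 := by
    have hs : HasDerivAt (fun t : ℝ => Real.sinh (t / 2)) (1 / 2) 0 := by
      simpa using ((hasDerivAt_id (0 : ℝ)).div_const 2).sinh
    have hc : HasDerivAt (fun t : ℝ => Real.cosh (t / 2)) 0 0 := by
      simpa using ((hasDerivAt_id (0 : ℝ)).div_const 2).cosh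
    have := hs.div hc (by simp)
    simp only [zero_div, Real.sinh_zero, Real.cosh_zero] at this
    refine (this.congr_deriv (by norm_num)).congr_of_eventuallyEq (.of_forall fun t => ?_)
    exact Real.tanh_eq_sinh_div_cosh _
  have h2 : HasDerivWithinAt (fun t => (γ.toFun t : E n)) ((1 / 2 : ℝ) • v) (Ici 0) 0 :=
    (h1.smul_const v).hasDerivWithinAt.congr (fun t ht => h t ht) (h 0 le_rfl)
  exact h2.derivWithin (uniqueDiffOn_Ici 0 0 self_mem_Ici)

theorem radialRay_zero (v : E n) (hv : ‖v‖ = 1) : (radialRay v hv).toFun 0 = origin n := by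
  ext1
  simp [radialRay, origin]

/-- Rays from the centre of the ball in different directions are not asymptotic. -/
theorem direction_eq_of_endpoint_eq {γ₁ γ₂ : GeodesicRay n} {v₁ v₂ : E n} (hv₁ : ‖v₁‖ = 1)
    (hv₂ : ‖v₂‖ = 1) (h₁ : ∀ t : ℝ, 0 ≤ t → (γ₁.toFun t : E n) = Real.tanh (t / 2) • v₁)
    (h₂ : ∀ t : ℝ, 0 ≤ t → (γ₂.toFun t : E n) = Real.tanh (t / 2) • v₂)
    (h : γ₁.endpoint = γ₂.endpoint) : v₁ = v₂ := by
  obtain ⟨C, hC⟩ : ∃ C : ℝ, ∀ t : ℝ, 0 ≤ t → hypDist (γ₁.toFun t) (γ₂.toFun t) ≤ C :=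
    Quotient.exact h
  have key : ∀ c : ℝ, 0 ≤ c → c * ‖v₁ - v₂‖ ≤ Real.sinh (C / 2) := by
    intro c hc
    have e := norm_sub_eq_of_norm_eq_tanh (x := γ₁.toFun (2 * c)) (y := γ₂.toFun (2 * c))
      (a := c) (b := c) (by rw [h₁ _ (by positivity), norm_smul, hv₁]; simp)
      (by rw [h₂ _ (by positivity), norm_smul, hv₂]; simp)
    rw [h₁ _ (by positivity), h₂ _ (by positivity), ← smul_sub, norm_smul,
      mul_div_cancel_left₀ _ two_ne_zero, Real.norm_of_nonneg (tanh_nonneg_of_nonneg hc),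
      eq_div_iff (by have := Real.cosh_pos c; positivity)] at e
    have hle : Real.sinh (hypDist (γ₁.toFun (2 * c)) (γ₂.toFun (2 * c)) / 2) ≤
        Real.sinh (C / 2) := Real.sinh_le_sinh.2 (by linarith [hC (2 * c) (by positivity)])
    refine le_trans ?_ hle
    rw [← e, Real.tanh_eq_sinh_div_cosh]
    have h1 := Real.one_le_cosh c
    have h2 := Real.self_le_sinh_iff.2 hc
    have h3 : Real.sinh c / Real.cosh c * ‖v₁ - v₂‖ * (Real.cosh c * Real.cosh c) =
        Real.sinh c * Real.cosh c * ‖v₁ - v₂‖ := by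
      field_simp
    rw [h3]
    have : c * 1 ≤ Real.sinh c * Real.cosh c := mul_le_mul h2 h1 zero_le_one (hc.trans h2)
    exact mul_le_mul_of_nonneg_right (by linarith) (norm_nonneg _)
  by_contra hne
  have hpos : 0 < ‖v₁ - v₂‖ := norm_pos_iff.2 (sub_ne_zero.2 hne)
  have := key ((|Real.sinh (C / 2)| + 1) / ‖v₁ - v₂‖) (by positivity)
  rw [div_mul_cancel₀ _ hpos.ne'] at this
  linarith [le_abs_self (Real.sinh (C / 2))]

theorem mem_coneInner_of_angle_lt {γ₀ : GeodesicRay n} {v₀ : E n}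
    (h0 : γ₀.toFun 0 = origin n)
    (h₀ : ∀ t : ℝ, 0 ≤ t → (γ₀.toFun t : E n) = Real.tanh (t / 2) • v₀) {θ R : ℝ} (hR : 0 ≤ R)
    {x : Hyp n} (hx : Real.tanh (R / 2) < ‖(x : E n)‖)
    (hθ : InnerProductGeometry.angle (x : E n) v₀ < θ / 2) : x ∈ coneInner γ₀ θ R := by
  have hpos : 0 < ‖(x : E n)‖ := (tanh_nonneg_of_nonneg (by linarith)).trans_lt hx
  have hlt : ‖(x : E n)‖ < 1 := mem_ball_zero_iff.1 x.2
  have hv : ‖‖(x : E n)‖⁻¹ • (x : E n)‖ = 1 := by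
    rw [norm_smul, norm_inv, norm_norm, inv_mul_cancel₀ hpos.ne']
  refine ⟨radialRay _ hv, by rw [radialRay_zero, h0], ?_, 2 * Real.artanh ‖(x : E n)‖, ?_, ?_⟩
  · rw [GeodesicRay.velocity_eq h₀, GeodesicRay.velocity_eq (γ := radialRay _ hv) (fun t _ => rfl),
      InnerProductGeometry.angle_smul_smul (by norm_num),
      InnerProductGeometry.angle_smul_left_of_pos _ _ (inv_pos.2 hpos)]
    exact hθ
  · have := Real.artanh_lt_artanh (Real.neg_one_lt_tanh (R / 2)) hlt hx
    rw [Real.artanh_tanh] at this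
    linarith
  · ext1
    simp only [radialRay]
    rw [mul_div_cancel_left₀ _ two_ne_zero, Real.tanh_artanh ⟨by linarith, hlt⟩, smul_smul,
      mul_inv_cancel₀ hpos.ne', one_smul]

theorem angle_lt_of_mem_coneInner {γ₀ : GeodesicRay n} {v₀ : E n}
    (h0 : γ₀.toFun 0 = origin n)
    (h₀ : ∀ t : ℝ, 0 ≤ t → (γ₀.toFun t : E n) = Real.tanh (t / 2) • v₀) {θ R : ℝ} (hR : 0 ≤ R)
    {x : Hyp n} (hx : x ∈ coneInner γ₀ θ R) : InnerProductGeometry.angle (x : E n) v₀ < θ / 2 := by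
  obtain ⟨γ, hγ0, hangle, t, ht, rfl⟩ := hx
  obtain ⟨v, hv, h⟩ := γ.exists_direction (hγ0.trans h0)
  rw [GeodesicRay.velocity_eq h₀, GeodesicRay.velocity_eq h,
    InnerProductGeometry.angle_smul_smul (by norm_num)] at hangle
  rwa [h t (by linarith),
    InnerProductGeometry.angle_smul_left_of_pos _ _ (tanh_pos_of_pos (by linarith))]

/-- Every neighbourhood of the ideal point of direction `ξ` in the cone topology contains the part
in the ball of a Euclidean neighbourhood of `ξ`. -/
theorem tendsto_inner_endpoint {ξ : E n} (hξ : ‖ξ‖ = 1) :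
    Tendsto HypClosure.inner (comap ((↑) : Hyp n → E n) (𝓝 ξ))
      (𝓝 (HypClosure.ideal (radialRay ξ hξ).endpoint)) := by
  refine TopologicalSpace.tendsto_nhds_generateFrom_iff.2 ?_
  rintro S (⟨U, -, rfl⟩ | ⟨γ₀, θ, R, h0, -, hR, rfl⟩) hmem
  · obtain ⟨x, -, hx⟩ := hmem
    cases hx
  obtain ⟨x, -, hx⟩ | ⟨q, ⟨γ, hγ0, hev, hend⟩, hq⟩ := hmem
  · cases hx
  rw [HypClosure.ideal.injEq] at hq
  obtain ⟨v₀, hv₀, h₀⟩ := γ₀.exists_direction h0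
  obtain ⟨v, hv, h⟩ := γ.exists_direction (hγ0.trans h0)
  obtain rfl : v = ξ :=
    direction_eq_of_endpoint_eq hv hξ h (γ₂ := radialRay ξ hξ) (fun t _ => rfl) (hend.trans hq)
  obtain ⟨t, htc, ht⟩ := (hev.and (eventually_gt_atTop 0)).exists
  have hangle := angle_lt_of_mem_coneInner h0 h₀ hR htc
  rw [h t ht.le,
    InnerProductGeometry.angle_smul_left_of_pos _ _ (tanh_pos_of_pos (by linarith))] at hangle
  have hne : v ≠ 0 := norm_ne_zero_iff.1 (by rw [hv]; exact one_ne_zero)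
  have hne₀ : v₀ ≠ 0 := norm_ne_zero_iff.1 (by rw [hv₀]; exact one_ne_zero)
  have c1 : ∀ᶠ z in 𝓝 v, InnerProductGeometry.angle z v₀ < θ / 2 := by
    have : ContinuousAt (fun z => InnerProductGeometry.angle z v₀) v :=
      (InnerProductGeometry.continuousAt_angle (x := (v, v₀)) hne hne₀).comp
        (f := fun z => (z, v₀)) (by fun_prop)
    exact this.eventually_lt_const hangle
  have c2 : ∀ᶠ z in 𝓝 v, Real.tanh (R / 2) < ‖z‖ :=
    continuous_norm.continuousAt.eventually_const_lt (by simpa only [hv] using Real.tanh_lt_one _)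
  filter_upwards [preimage_mem_comap (c1.and c2)] with x hx
  exact Or.inl ⟨x, mem_coneInner_of_angle_lt h0 h₀ hR hx.2 hx.1, rfl⟩

/-- The points of the unit sphere in the Euclidean closure of `Ω` give points of the asymptotic
boundary. -/
theorem ideal_mem_asymptoticBoundary {Ω : Set (Hyp n)} {ξ : E n} (hξ : ‖ξ‖ = 1)
    (h : ξ ∈ closure (Subtype.val '' Ω)) :
    HypClosure.ideal (radialRay ξ hξ).endpoint ∈ asymptoticBoundary Ω := by
  refine ⟨⟨?_, fun hint => ?_⟩, ?_⟩
  · have hne : (comap ((↑) : Hyp n → E n) (𝓝 ξ) ⊓ 𝓟 Ω).NeBot := by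
      rw [inf_principal_neBot_iff]
      rintro U hU
      obtain ⟨V, hV, hVU⟩ := hU
      obtain ⟨_, hzV, x, hx, rfl⟩ := mem_closure_iff_nhds.1 h V hV
      exact ⟨x, hVU hzV, hx⟩
    exact mem_closure_of_tendsto ((tendsto_inner_endpoint hξ).mono_left inf_le_left)
      (mem_inf_of_right (mem_principal.2 fun x hx => mem_image_of_mem _ hx))
  · obtain ⟨x, -, hx⟩ := interior_subset hint
    cases hx
  · rintro ⟨x, -, hx⟩
    cases hx

/-- If the asymptotic boundary of `Ω` is a single point, then the Euclidean closure of `Ω` meets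
the unit sphere in at most one point. -/
theorem exists_unit_of_asymptoticBoundary_eq_singleton (hn : 2 ≤ n) {Ω : Set (Hyp n)}
    {p : HypClosure n} (hp : asymptoticBoundary Ω = {p}) :
    ∃ ζ : E n, ‖ζ‖ = 1 ∧ ∀ ξ : E n, ‖ξ‖ = 1 → ξ ∈ closure (Subtype.val '' Ω) → ξ = ζ := by
  by_cases h : ∃ ζ : E n, ‖ζ‖ = 1 ∧ ζ ∈ closure (Subtype.val '' Ω)
  · obtain ⟨ζ, hζ, hmem⟩ := h
    refine ⟨ζ, hζ, fun ξ hξ hξm => ?_⟩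
    have h1 := ideal_mem_asymptoticBoundary hξ hξm
    have h2 := ideal_mem_asymptoticBoundary hζ hmem
    rw [hp, mem_singleton_iff] at h1 h2
    have h3 := h1.trans h2.symm
    rw [HypClosure.ideal.injEq] at h3
    exact direction_eq_of_endpoint_eq hξ hζ (γ₁ := radialRay ξ hξ) (γ₂ := radialRay ζ hζ)
      (fun t _ => rfl) (fun t _ => rfl) h3
  · exact ⟨EuclideanSpace.single ⟨0, by omega⟩ 1, by simp, fun ξ hξ hξm => absurd ⟨ξ, hξ, hξm⟩ h⟩

end HypBall

namespace HypBall

open Metric Set Filter Topology Laplacian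

variable {n : ℕ}

/-! ### Second derivatives along lines and local maxima -/

theorem iteratedFDeriv_two_eq_of_hasLineDerivAt {F : Type*} [NormedAddCommGroup F]
    [NormedSpace ℝ F] {h G : F → ℝ} {x e : F} {d : ℝ}
    (hh : ContDiffAt ℝ 2 h x) (hG : ∀ᶠ y in 𝓝 x, fderiv ℝ h y e = G y)
    (hd : HasLineDerivAt ℝ G d x e) : iteratedFDeriv ℝ 2 h x ![e, e] = d := by
  have h1 : DifferentiableAt ℝ (fderiv ℝ h) x :=
    (hh.fderiv_right (m := 1) (by norm_num)).differentiableAt (by norm_num)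
  have h2 : HasFDerivAt (fun y => fderiv ℝ h y e) ((fderiv ℝ (fderiv ℝ h) x).flip e) x := by
    simpa using h1.hasFDerivAt.clm_apply (hasFDerivAt_const e x)
  have h3 : HasLineDerivAt ℝ G (((fderiv ℝ (fderiv ℝ h) x).flip e) e) x e :=
    (h2.congr_of_eventuallyEq (hG.mono fun y hy => hy.symm)).hasLineDerivAt e
  rw [iteratedFDeriv_two_apply]
  exact h3.lineDeriv.symm.trans hd.lineDeriv

theorem iteratedFDeriv_two_nonpos_of_isLocalMax {F : Type*} [NormedAddCommGroup F]
    [NormedSpace ℝ F] {h : F → ℝ} {x : F} (hh : ContDiffAt ℝ 2 h x)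
    (hmax : IsLocalMax h x) (e : F) : iteratedFDeriv ℝ 2 h x ![e, e] ≤ 0 := by
  have h1 : DifferentiableAt ℝ (fderiv ℝ h) x :=
    (hh.fderiv_right (m := 1) (by norm_num)).differentiableAt (by norm_num)
  have h2 : HasFDerivAt (fun y => fderiv ℝ h y e) ((fderiv ℝ (fderiv ℝ h) x).flip e) x := by
    simpa using h1.hasFDerivAt.clm_apply (hasFDerivAt_const e x)
  have hline : Continuous fun t : ℝ => x + t • e := by fun_prop
  have hline0 : Tendsto (fun t : ℝ => x + t • e) (𝓝 0) (𝓝 x) := by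
    simpa using hline.tendsto 0
  set φ : ℝ → ℝ := fun t => h (x + t • e) with hφ
  have hderiv : deriv φ =ᶠ[𝓝 0] fun t => fderiv ℝ h (x + t • e) e := by
    have hev : ∀ᶠ y in 𝓝 x, DifferentiableAt ℝ h y :=
      (hh.eventually (by simp)).mono fun y hy => hy.differentiableAt (by norm_num)
    filter_upwards [hline0.eventually hev] with t ht
    have : HasDerivAt (fun t : ℝ => x + t • e) e t := by
      simpa using ((hasDerivAt_id t).smul_const e).const_add x
    exact (ht.hasFDerivAt.comp_hasDerivAt t this).deriv
  have hφmax : IsLocalMax φ 0 := by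
    have : ∀ᶠ y in 𝓝 x, h y ≤ h x := hmax
    filter_upwards [hline0.eventually this] with t ht
    simpa [hφ] using ht
  have hdd : deriv (deriv φ) 0 = iteratedFDeriv ℝ 2 h x ![e, e] := by
    rw [hderiv.deriv_eq, iteratedFDeriv_two_apply]
    exact (h2.hasLineDerivAt e).lineDeriv
  by_contra! hpos
  rw [← hdd] at hpos
  have hcont : ContinuousAt φ 0 := by
    refine ContinuousAt.comp (g := h) ?_ hline.continuousAt
    simpa using hh.continuousAt
  -- the second derivative test makes `0` a local minimum too, so `φ` is locally constant
  have hmin := isLocalMin_of_deriv_deriv_pos hpos hφmax.deriv_eq_zero hcont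
  have hconst : φ =ᶠ[𝓝 0] fun _ => φ 0 := by
    filter_upwards [hφmax, hmin] with t h1 h2 using le_antisymm h1 h2
  have := hconst.deriv.deriv_eq
  simp at this
  linarith

theorem laplacian_eq_sum (h : E n → ℝ) (x : E n) :
    Δ h x =
      ∑ i, iteratedFDeriv ℝ 2 h x ![EuclideanSpace.single i 1, EuclideanSpace.single i 1] := by
  rw [InnerProductSpace.laplacian_eq_iteratedFDeriv_orthonormalBasis h
    (EuclideanSpace.basisFun (Fin n) ℝ)]
  simp

theorem laplacian_nonpos_of_isLocalMax {h : E n → ℝ} {x : E n} (hh : ContDiffAt ℝ 2 h x)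
    (hmax : IsLocalMax h x) : Δ h x ≤ 0 := by
  rw [laplacian_eq_sum]
  exact Finset.sum_nonpos fun i _ => iteratedFDeriv_two_nonpos_of_isLocalMax hh hmax _

/-! ### The Laplacian of a function of the distance to a totally geodesic hypersurface -/

/-- The Laplace–Beltrami operator of the ball on functions of the coordinates. -/
noncomputable def ballLaplacian (f : E n → ℝ) (x : E n) : ℝ :=
  (rho x)⁻¹ ^ 2 * Δ f x + ((n : ℝ) - 2) * (rho x)⁻¹ * fderiv ℝ f x x

/-- The function `sinh t`, where `t` is the signed hyperbolic distance to the totally geodesic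
hypersurface with unit normal `(α, β ζ)` in the hyperboloid model (`‖ζ‖ = 1`, `β² = 1 + α²`). Its
positive side is the complement of a half-space around the ideal point `ζ`, and this half-space
shrinks to `ζ` as `α → ∞`. -/
noncomputable def sinhDist (α β : ℝ) (ζ x : E n) : ℝ :=
  (α * (1 + ‖x‖ ^ 2) - 2 * β * inner ℝ ζ x) / (1 - ‖x‖ ^ 2)

/-- The Euclidean gradient of `sinhDist`. -/
noncomputable def sinhDistGrad (α β : ℝ) (ζ x : E n) : E n :=
  (1 - ‖x‖ ^ 2)⁻¹ • ((2 * (α + sinhDist α β ζ x)) • x - (2 * β) • ζ)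

theorem contDiffAt_sinhDist (α β : ℝ) (ζ : E n) {x : E n} (hx : x ∈ ball (0 : E n) 1) :
    ContDiffAt ℝ 2 (sinhDist α β ζ) x := by
  have h0 := (one_sub_normSq_pos_of_mem_ball hx).ne'
  unfold sinhDist
  refine ContDiffAt.div ?_ ?_ h0
  · exact (contDiffAt_const.mul (contDiffAt_const.add (contDiff_norm_sq ℝ).contDiffAt)).sub
      (contDiffAt_const.mul (contDiffAt_const.inner ℝ contDiffAt_id))
  · exact contDiffAt_const.sub (contDiff_norm_sq ℝ).contDiffAt

theorem hasFDerivAt_sinhDist (α β : ℝ) (ζ : E n) {x : E n} (hx : x ∈ ball (0 : E n) 1) :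
    HasFDerivAt (sinhDist α β ζ) (innerSL ℝ (sinhDistGrad α β ζ x)) x := by
  have h0 := (one_sub_normSq_pos_of_mem_ball hx).ne'
  have hsq := (hasStrictFDerivAt_norm_sq x).hasFDerivAt
  have hp := ((hsq.const_add 1).const_mul α).sub ((innerSL ℝ ζ).hasFDerivAt.const_mul (2 * β))
  have h := hp.mul ((hasDerivAt_inv h0).comp_hasFDerivAt x (hsq.const_sub 1))
  refine (h.congr_fderiv ?_).congr_of_eventuallyEq (.of_forall fun y => div_eq_mul_inv _ _)
  ext y
  simp only [sinhDistGrad, sinhDist, innerSL_apply_apply, inner_smul_left, inner_sub_left,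
    smul_apply, sub_apply, neg_apply, add_apply, smul_eq_mul, RCLike.conj_to_real, two_smul,
    Function.comp_apply, Pi.sub_apply]
  field_simp
  ring

/-- The second derivative of `sinhDist` in the direction of a unit vector. -/
theorem hasDerivAt_inner_sinhDistGrad (α β : ℝ) (ζ : E n) {x e : E n}
    (hx : x ∈ ball (0 : E n) 1) (he : ‖e‖ = 1) :
    HasDerivAt (fun t : ℝ => inner ℝ (sinhDistGrad α β ζ (x + t • e)) e)
      ((2 * (α + sinhDist α β ζ x) + 4 * inner ℝ x e * inner ℝ (sinhDistGrad α β ζ x) e) /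
        (1 - ‖x‖ ^ 2)) 0 := by
  have h0 := (one_sub_normSq_pos_of_mem_ball hx).ne'
  have hl : HasDerivAt (fun t : ℝ => x + t • e) e 0 := by
    simpa using ((hasDerivAt_id (0 : ℝ)).smul_const e).const_add x
  have hX : HasDerivAt (fun t : ℝ => sinhDist α β ζ (x + t • e))
      (inner ℝ (sinhDistGrad α β ζ x) e) 0 := by
    have := (hasFDerivAt_sinhDist α β ζ (x := x + (0 : ℝ) • e) (by simpa using hx)).comp_hasDerivAt
      (0 : ℝ) hl
    rw [zero_smul, add_zero] at this
    exact this
  have hi : HasDerivAt (fun t : ℝ => inner ℝ (x + t • e) e) 1 0 := by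
    have := hl.inner ℝ (hasDerivAt_const (0 : ℝ) e)
    simpa [he] using this
  have hq : HasDerivAt (fun t : ℝ => 1 - ‖x + t • e‖ ^ 2) (-(2 * inner ℝ x e)) 0 := by
    have := hl.norm_sq.const_sub 1
    simpa using this
  have h := (((hX.const_add α).const_mul 2).mul hi |>.sub_const (2 * β * inner ℝ ζ e)).div hq
    (by simpa using h0)
  refine (h.congr_deriv ?_).congr_of_eventuallyEq (.of_forall fun t => ?_)
  · simp only [zero_smul, add_zero, sinhDistGrad, inner_smul_left, inner_sub_left,
      RCLike.conj_to_real, Pi.mul_apply]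
    field_simp
    ring
  · simp only [sinhDistGrad, inner_smul_left, inner_sub_left, RCLike.conj_to_real, Pi.div_apply,
      Pi.mul_apply]
    ring

/-- The chain rule for the Laplace–Beltrami operator and a function of `X = sinhDist`, in the form
`Δ (F ∘ X) = (1 + X²) F''(X) + n X F'(X)`; it says that `|∇X|² = 1 + X²` and `ΔX = n X`. -/
theorem ballLaplacian_comp_sinhDist {α β : ℝ} (hβ : β ^ 2 = 1 + α ^ 2) {ζ : E n} (hζ : ‖ζ‖ = 1)
    {F F' : ℝ → ℝ} {F'' : ℝ} {x : E n} (hx : x ∈ ball (0 : E n) 1)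
    (hF : ContDiffAt ℝ 2 F (sinhDist α β ζ x))
    (hF' : ∀ᶠ X in 𝓝 (sinhDist α β ζ x), HasDerivAt F (F' X) X)
    (hF'' : HasDerivAt F' F'' (sinhDist α β ζ x)) :
    ballLaplacian (fun y => F (sinhDist α β ζ y)) x =
      (1 + sinhDist α β ζ x ^ 2) * F'' + n * sinhDist α β ζ x * F' (sinhDist α β ζ x) := by
  have h0 := one_sub_normSq_pos_of_mem_ball hx
  have hcd : ContDiffAt ℝ 2 (fun y => F (sinhDist α β ζ y)) x :=
    hF.comp x (contDiffAt_sinhDist α β ζ hx)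
  have hfd : ∀ y ∈ ball (0 : E n) 1, HasDerivAt F (F' (sinhDist α β ζ y)) (sinhDist α β ζ y) →
      ∀ e, fderiv ℝ (fun y => F (sinhDist α β ζ y)) y e =
        F' (sinhDist α β ζ y) * inner ℝ (sinhDistGrad α β ζ y) e := by
    intro y hy hFy e
    have := hFy.comp_hasFDerivAt y (hasFDerivAt_sinhDist α β ζ hy)
    have h2 : fderiv ℝ (fun y => F (sinhDist α β ζ y)) y =
      F' (sinhDist α β ζ y) • innerSL ℝ (sinhDistGrad α β ζ y) := this.fderiv
    rw [h2]
    simp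
  have hXc : ContinuousAt (sinhDist α β ζ) x := (contDiffAt_sinhDist α β ζ hx).continuousAt
  set X := sinhDist α β ζ x with hX
  have hsecond : ∀ i : Fin n, iteratedFDeriv ℝ 2 (fun y => F (sinhDist α β ζ y)) x
      ![EuclideanSpace.single i 1, EuclideanSpace.single i 1] =
      F'' * (((1 - ‖x‖ ^ 2)⁻¹ * (2 * (α + X) * x i - 2 * β * ζ i)) *
        ((1 - ‖x‖ ^ 2)⁻¹ * (2 * (α + X) * x i - 2 * β * ζ i))) +
      F' X * ((2 * (α + X) + 4 * x i *
        ((1 - ‖x‖ ^ 2)⁻¹ * (2 * (α + X) * x i - 2 * β * ζ i))) / (1 - ‖x‖ ^ 2)) := by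
    intro i
    have hgi : inner ℝ (sinhDistGrad α β ζ x) (EuclideanSpace.single i (1 : ℝ)) =
        (1 - ‖x‖ ^ 2)⁻¹ * (2 * (α + X) * x i - 2 * β * ζ i) := by
      rw [EuclideanSpace.inner_single_right]
      simp [sinhDistGrad, hX]
    have hxi : inner ℝ x (EuclideanSpace.single i (1 : ℝ)) = x i := by
      rw [EuclideanSpace.inner_single_right]
      simp
    refine iteratedFDeriv_two_eq_of_hasLineDerivAt hcd (G := fun y => F' (sinhDist α β ζ y) *
      inner ℝ (sinhDistGrad α β ζ y) (EuclideanSpace.single i 1)) ?_ ?_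
    · filter_upwards [isOpen_ball.mem_nhds hx, hXc.eventually hF'] with y hy hFy
      exact hfd y hy hFy _
    · have hl : HasDerivAt (fun t : ℝ => x + t • EuclideanSpace.single i (1 : ℝ))
          (EuclideanSpace.single i 1) 0 := by
        simpa using ((hasDerivAt_id (0 : ℝ)).smul_const
          (EuclideanSpace.single i (1 : ℝ))).const_add x
      have h1 : HasDerivAt (fun t : ℝ => sinhDist α β ζ (x + t • EuclideanSpace.single i (1 : ℝ)))
          (inner ℝ (sinhDistGrad α β ζ x) (EuclideanSpace.single i 1)) 0 :=
        ((hasFDerivAt_sinhDist α β ζ hx).hasLineDerivAt _)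
      have h2 := hasDerivAt_inner_sinhDistGrad α β ζ (e := EuclideanSpace.single i 1) hx
        (by simp)
      have hF0 : HasDerivAt F' F''
          (sinhDist α β ζ (x + (0 : ℝ) • EuclideanSpace.single i (1 : ℝ))) := by
        simpa using hF''
      have h3 := (hF0.comp (0 : ℝ) h1).mul h2
      refine HasDerivAt.congr_deriv h3 ?_
      simp only [Function.comp_apply, zero_smul, add_zero, hgi, hxi, ← hX]
      ring
  have hgrad : fderiv ℝ (fun y => F (sinhDist α β ζ y)) x x =
      F' X * ((1 - ‖x‖ ^ 2)⁻¹ * (2 * (α + X) * ‖x‖ ^ 2 - 2 * β * inner ℝ ζ x)) := by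
    rw [hfd x hx hF'.self_of_nhds]
    simp [sinhDistGrad, inner_smul_left, inner_sub_left, ← hX]
  have hs1 : ∑ i, x i * x i = ‖x‖ ^ 2 := by
    rw [EuclideanSpace.real_norm_sq_eq]; simp [sq]
  have hs2 : ∑ i, x i * ζ i = inner ℝ ζ x := by
    simp [PiLp.inner_apply]
  have hs3 : ∑ i, ζ i * ζ i = 1 := by
    rw [← one_pow 2, ← hζ, EuclideanSpace.real_norm_sq_eq]; simp [sq]
  have hXeq : X * (1 - ‖x‖ ^ 2) = α * (1 + ‖x‖ ^ 2) - 2 * β * inner ℝ ζ x := by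
    rw [hX, sinhDist, div_mul_cancel₀ _ h0.ne']
  have hlap : Δ (fun y => F (sinhDist α β ζ y)) x =
      F'' * ((1 - ‖x‖ ^ 2)⁻¹ ^ 2 * (4 * (α + X) ^ 2 * ‖x‖ ^ 2 -
        8 * (α + X) * β * inner ℝ ζ x + 4 * β ^ 2)) +
      F' X * ((1 - ‖x‖ ^ 2)⁻¹ * (2 * n * (α + X)) + (1 - ‖x‖ ^ 2)⁻¹ ^ 2 *
        (8 * (α + X) * ‖x‖ ^ 2 - 8 * β * inner ℝ ζ x)) := by
    rw [laplacian_eq_sum, Finset.sum_congr rfl fun i _ => hsecond i]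
    have hterm : ∀ i : Fin n, F'' * (((1 - ‖x‖ ^ 2)⁻¹ * (2 * (α + X) * x i - 2 * β * ζ i)) *
        ((1 - ‖x‖ ^ 2)⁻¹ * (2 * (α + X) * x i - 2 * β * ζ i))) +
      F' X * ((2 * (α + X) + 4 * x i *
        ((1 - ‖x‖ ^ 2)⁻¹ * (2 * (α + X) * x i - 2 * β * ζ i))) / (1 - ‖x‖ ^ 2)) =
      F' X * ((1 - ‖x‖ ^ 2)⁻¹ * (2 * (α + X))) +
      (F'' * (1 - ‖x‖ ^ 2)⁻¹ ^ 2 * (4 * (α + X) ^ 2) +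
        F' X * (1 - ‖x‖ ^ 2)⁻¹ ^ 2 * (8 * (α + X))) * (x i * x i) -
      (F'' * (1 - ‖x‖ ^ 2)⁻¹ ^ 2 * (8 * (α + X) * β) +
        F' X * (1 - ‖x‖ ^ 2)⁻¹ ^ 2 * (8 * β)) * (x i * ζ i) +
      (F'' * (1 - ‖x‖ ^ 2)⁻¹ ^ 2 * (4 * β ^ 2)) * (ζ i * ζ i) := by
      intro i
      ring
    rw [Finset.sum_congr rfl fun i _ => hterm i, Finset.sum_add_distrib, Finset.sum_sub_distrib,
      Finset.sum_add_distrib, Finset.sum_const, Finset.card_univ, Fintype.card_fin, nsmul_eq_mul,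
      ← Finset.mul_sum, ← Finset.mul_sum, ← Finset.mul_sum, hs1, hs2, hs3]
    ring
  rw [ballLaplacian, hlap, hgrad, rho, inv_div]
  -- eliminate `⟨ζ, x⟩` and `β²`
  have hin : 2 * β * inner ℝ ζ x = α * (1 + ‖x‖ ^ 2) - X * (1 - ‖x‖ ^ 2) := by linarith
  have e1 : 8 * (α + X) * β * inner ℝ ζ x =
      4 * (α + X) * (α * (1 + ‖x‖ ^ 2) - X * (1 - ‖x‖ ^ 2)) := by rw [← hin]; ring
  have e2 : 8 * β * inner ℝ ζ x = 4 * (α * (1 + ‖x‖ ^ 2) - X * (1 - ‖x‖ ^ 2)) := by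
    rw [← hin]; ring
  rw [e1, e2, hin, hβ]
  generalize ‖x‖ ^ 2 = r at h0 ⊢
  have h0' : 1 - r ≠ 0 := h0.ne'
  field_simp
  ring

/-! ### The profile of the barriers -/

/-- The profile `X⁻ᵃ - X⁻ᵃ⁻¹` of the barriers. -/
noncomputable def profile (a X : ℝ) : ℝ := X ^ (-a) - X ^ (-a - 1)

/-- The derivative of `profile`. -/
noncomputable def profileDeriv (a X : ℝ) : ℝ := -a * X ^ (-a - 1) + (a + 1) * X ^ (-a - 2)

theorem hasDerivAt_profile (a : ℝ) {X : ℝ} (hX : 0 < X) :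
    HasDerivAt (profile a) (profileDeriv a X) X := by
  have h := (Real.hasDerivAt_rpow_const (p := -a) (Or.inl hX.ne')).sub
    (Real.hasDerivAt_rpow_const (p := -a - 1) (Or.inl hX.ne'))
  refine h.congr_deriv ?_
  rw [profileDeriv, show -a - 1 - 1 = -a - 2 by ring]
  ring

theorem hasDerivAt_profileDeriv (a : ℝ) {X : ℝ} (hX : 0 < X) :
    HasDerivAt (profileDeriv a)
      (a * (a + 1) * X ^ (-a - 2) - (a + 1) * (a + 2) * X ^ (-a - 3)) X := by
  have h := ((Real.hasDerivAt_rpow_const (p := -a - 1) (Or.inl hX.ne')).const_mul (-a)).add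
    ((Real.hasDerivAt_rpow_const (p := -a - 2) (Or.inl hX.ne')).const_mul (a + 1))
  refine h.congr_deriv ?_
  rw [show -a - 1 - 1 = -a - 2 by ring, show -a - 2 - 1 = -a - 3 by ring]
  ring

theorem contDiffAt_profile (a : ℝ) {X : ℝ} (hX : 0 < X) : ContDiffAt ℝ 2 (profile a) X :=
  (Real.contDiffAt_rpow_const_of_ne hX.ne').sub (Real.contDiffAt_rpow_const_of_ne hX.ne')

theorem profile_pos (a : ℝ) {X : ℝ} (hX : 1 < X) : 0 < profile a X :=
  sub_pos.2 (Real.rpow_lt_rpow_of_exponent_lt hX (by linarith))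

theorem tendsto_profile_atTop {a : ℝ} (ha : 0 < a) : Tendsto (profile a) atTop (𝓝 0) := by
  have h := (tendsto_rpow_neg_atTop ha).sub (tendsto_rpow_neg_atTop (y := a + 1) (by linarith))
  rw [sub_zero] at h
  refine h.congr fun X => ?_
  rw [profile, neg_add']

/-- For large `X` the profile is a strict supersolution of the ordinary differential equation of the
`a²`-harmonic functions of `X = sinhDist` on `ℍⁿ`, `n = 2 a + 1`: the terms of order `X⁻ᵃ` cancel
since the indicial polynomial `(m - a)²` of the equation has the double root `a`, and what remains
is led by `-X⁻ᵃ⁻¹`. -/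
theorem profile_strict_supersolution {a X : ℝ} (ha : 0 < a) (hX : a * (a + 1) + 1 ≤ X) :
    (1 + X ^ 2) * (a * (a + 1) * X ^ (-a - 2) - (a + 1) * (a + 2) * X ^ (-a - 3)) +
      (2 * a + 1) * X * profileDeriv a X + a ^ 2 * profile a X < 0 := by
  have hX0 : 0 < X := by nlinarith
  have hP : 0 < X ^ (-a - 3) := Real.rpow_pos_of_pos hX0 _
  have h2 : X ^ (-a - 2) = X ^ (-a - 3) * X := by
    rw [← Real.rpow_add_one hX0.ne']; ring_nf
  have h1 : X ^ (-a - 1) = X ^ (-a - 3) * X ^ 2 := by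
    rw [← Real.rpow_add_natCast hX0.ne']; norm_num; ring_nf
  have h0 : X ^ (-a) = X ^ (-a - 3) * X ^ 3 := by
    rw [← Real.rpow_add_natCast hX0.ne']; norm_num
  rw [profileDeriv, profile, h0, h1, h2]
  have e : (1 + X ^ 2) * (a * (a + 1) * (X ^ (-a - 3) * X) - (a + 1) * (a + 2) * X ^ (-a - 3)) +
      (2 * a + 1) * X * (-a * (X ^ (-a - 3) * X ^ 2) + (a + 1) * (X ^ (-a - 3) * X)) +
      a ^ 2 * (X ^ (-a - 3) * X ^ 3 - X ^ (-a - 3) * X ^ 2) =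
      X ^ (-a - 3) * (X * (a * (a + 1) - X) - (a + 1) * (a + 2)) := by ring
  rw [e]
  refine mul_neg_of_pos_of_neg hP ?_
  nlinarith

end HypBall

/-! ### Comparison with the barriers -/

namespace HypBall

open Metric Set Filter Topology Laplacian

variable {n : ℕ}

theorem inCoords_coe (u : Hyp n → ℝ) (x : Hyp n) : inCoords u x = u x :=
  Subtype.val_injective.extend_apply u 0 x

theorem inCoords_neg (u : Hyp n → ℝ) : inCoords (-u) = -inCoords u := by
  funext x
  by_cases h : ∃ y : Hyp n, (y : E n) = x
  · obtain ⟨y, rfl⟩ := h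
    simp [inCoords_coe]
  · simp [inCoords, Function.extend_apply' _ _ _ h]

theorem IsLambdaHarmonic.neg {lam : ℝ} {Ω : Set (Hyp n)} {u : Hyp n → ℝ}
    (hu : IsLambdaHarmonic lam Ω u) : IsLambdaHarmonic lam Ω (-u) where
  nontrivial := by
    obtain ⟨x, hx, h⟩ := hu.nontrivial
    exact ⟨x, hx, by simpa using h⟩
  continuousOn := hu.continuousOn.neg
  contDiffOn := by rw [inCoords_neg]; exact hu.contDiffOn.neg
  equation := by
    intro x hx
    have := hu.equation x hx
    simp only [hypLaplacian, inCoords_neg, InnerProductSpace.laplacian_neg, fderiv_neg,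
      Pi.neg_apply, neg_apply] at this ⊢
    linarith
  boundary x hx := by simp [hu.boundary x hx]

/-- The maximum principle for `f - m W`: the gradient vanishes at a local maximum, so the
first-order term of the Laplace–Beltrami operator drops out. -/
theorem ballLaplacian_le_of_isLocalMax {f W : E n → ℝ} {x : E n} {m : ℝ}
    (hf : ContDiffAt ℝ 2 f x) (hW : ContDiffAt ℝ 2 W x)
    (hmax : IsLocalMax (f - m • W) x) : ballLaplacian f x ≤ m * ballLaplacian W x := by
  have hmW : ContDiffAt ℝ 2 (m • W) x := contDiffAt_const.smul hW
  have h1 : Δ (f - m • W) x ≤ 0 := laplacian_nonpos_of_isLocalMax (hf.sub hmW) hmax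
  rw [hf.laplacian_sub hmW, InnerProductSpace.laplacian_smul m hW, smul_eq_mul] at h1
  have h2 : fderiv ℝ f x x = m * fderiv ℝ W x x := by
    have h := hmax.fderiv_eq_zero
    rw [fderiv_sub (hf.differentiableAt (by norm_num)) (hmW.differentiableAt (by norm_num)),
      fderiv_const_smul (hW.differentiableAt (by norm_num)), sub_eq_zero] at h
    rw [h]
    simp
  unfold ballLaplacian
  rw [h2]
  nlinarith [mul_le_mul_of_nonneg_left h1 (sq_nonneg (rho x)⁻¹)]

/-- If the Euclidean closure of `Ω` meets the unit sphere at most in `ζ`, then removing from `Ω`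
a neighbourhood of `ζ` of the form `{sinhDist < S}` leaves a relatively compact set. -/
theorem isCompact_closure_inter_le_sinhDist {Ω : Set (Hyp n)} {ζ : E n} (hζ : ‖ζ‖ = 1)
    (hΩ : ∀ ξ : E n, ‖ξ‖ = 1 → ξ ∈ closure (Subtype.val '' Ω) → ξ = ζ) {α β : ℝ} (hαβ : α < β)
    (S : ℝ) : IsCompact (closure Ω ∩ {x : Hyp n | S ≤ sinhDist α β ζ (x : E n)}) := by
  set K : Set (E n) := closure (Subtype.val '' Ω) ∩
    {z | S * (1 - ‖z‖ ^ 2) ≤ α * (1 + ‖z‖ ^ 2) - 2 * β * inner ℝ ζ z} with hK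
  have hΩb : closure (Subtype.val '' Ω) ⊆ closedBall (0 : E n) 1 :=
    closure_minimal (by rintro _ ⟨x, -, rfl⟩; exact ball_subset_closedBall x.2) isClosed_closedBall
  have hKc : IsCompact K := by
    refine (isCompact_closedBall (0 : E n) 1).of_isClosed_subset ?_ (inter_subset_left.trans hΩb)
    exact isClosed_closure.inter (isClosed_le (by fun_prop) (by fun_prop))
  have hKb : K ⊆ ball (0 : E n) 1 := by
    rintro z ⟨hz, hzS⟩
    have hle : ‖z‖ ≤ 1 := mem_closedBall_zero_iff.1 (hΩb hz)
    refine mem_ball_zero_iff.2 (lt_of_le_of_ne hle fun h1 => ?_)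
    obtain rfl := hΩ z h1 hz
    simp only [mem_ofPred_eq, real_inner_self_eq_norm_sq, h1] at hzS
    linarith
  rw [Subtype.isCompact_iff]
  convert hKc using 1
  ext z
  constructor
  · rintro ⟨x, ⟨hx, hxS⟩, rfl⟩
    refine ⟨?_, (le_div_iff₀ (one_sub_normSq_pos x)).1 hxS⟩
    rw [closure_subtype] at hx
    exact hx
  · intro hz
    refine ⟨⟨z, hKb hz⟩, ⟨closure_subtype.2 hz.1, ?_⟩, rfl⟩
    exact (le_div_iff₀ (one_sub_normSq_pos_of_mem_ball (hKb hz))).2 hz.2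

/-- Comparison with the barrier `profile a ∘ sinhDist`, on the part of `Ω` outside a half-space
around its only ideal boundary point. -/
theorem IsLambdaHarmonic.le_profile {lam : ℝ} {Ω : Set (Hyp n)} {u : Hyp n → ℝ}
    (hu : IsLambdaHarmonic lam Ω u) (hopen : IsOpen Ω) {M : ℝ} (hM : 0 ≤ M)
    (huM : ∀ x ∈ Ω, u x ≤ M) {a : ℝ} (ha : 0 < a) (hna : (n : ℝ) = 2 * a + 1)
    (hlam : lam ≤ a ^ 2) {ζ : E n} (hζ : ‖ζ‖ = 1)
    (hΩ : ∀ ξ : E n, ‖ξ‖ = 1 → ξ ∈ closure (Subtype.val '' Ω) → ξ = ζ) {α β : ℝ}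
    (hαβ : α < β) (hβ : β ^ 2 = 1 + α ^ 2) {x : Hyp n} (hx : x ∈ Ω)
    (hxS : a * (a + 1) + 1 ≤ sinhDist α β ζ (x : E n)) :
    u x ≤ M / profile a (a * (a + 1) + 1) * profile a (sinhDist α β ζ (x : E n)) := by
  set S := a * (a + 1) + 1 with hS
  have hS1 : 1 < S := by nlinarith
  have hFS := profile_pos a hS1
  set W : E n → ℝ := fun y => profile a (sinhDist α β ζ y) with hW
  have hcd : ∀ y ∈ ball (0 : E n) 1, S ≤ sinhDist α β ζ y → ContDiffAt ℝ 2 W y := fun y hy hyS =>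
    (contDiffAt_profile a (by linarith)).comp y (contDiffAt_sinhDist α β ζ hy)
  have hWpos : ∀ y : E n, S ≤ sinhDist α β ζ y → 0 < W y := fun y hy =>
    profile_pos a (by linarith)
  by_contra! hlt
  set K := closure Ω ∩ {x : Hyp n | S ≤ sinhDist α β ζ (x : E n)}
  have hKcont : ContinuousOn (fun y : Hyp n => u y / W y) K := by
    refine (hu.continuousOn.mono inter_subset_left).div (fun y hy => ?_)
      fun y hy => (hWpos y hy.2).ne'
    exact ((hcd y y.2 hy.2).continuousAt.comp
      continuous_subtype_val.continuousAt).continuousWithinAt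
  obtain ⟨y, hyK, hymax⟩ := (isCompact_closure_inter_le_sinhDist hζ hΩ hαβ S).exists_isMaxOn
    ⟨x, subset_closure hx, hxS⟩ hKcont
  set m := u y / W y with hm
  have hCm : M / profile a S < m :=
    ((lt_div_iff₀ (hWpos x hxS)).2 hlt).trans_le (hymax ⟨subset_closure hx, hxS⟩)
  have hm0 : 0 < m := (div_nonneg hM hFS.le).trans_lt hCm
  have huy : u y = m * W y := by rw [hm, div_mul_cancel₀ _ (hWpos y hyK.2).ne']
  have hyΩ : y ∈ Ω := by
    by_contra hyΩ
    have h0 : u y = 0 := hu.boundary y ⟨hyK.1, by rwa [hopen.interior_eq]⟩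
    rw [hm, h0, zero_div] at hm0
    exact lt_irrefl _ hm0
  have hyS : S < sinhDist α β ζ (y : E n) := by
    refine lt_of_le_of_ne hyK.2 fun h => ?_
    have hWy : W y = profile a S := by rw [hW, h]
    rw [hm, hWy] at hCm
    exact absurd (huM y hyΩ) (not_le.2 ((div_lt_div_iff_of_pos_right hFS).1 hCm))
  -- `y` is an interior point of the region, so `u - m W` has a local maximum there
  have hfy : ContDiffAt ℝ 2 (inCoords u) (y : E n) :=
    hu.contDiffOn.contDiffAt
      ((isOpen_ball.isOpenMap_subtype_val Ω hopen).mem_nhds ⟨y, hyΩ, rfl⟩)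
  have hmax : IsLocalMax (inCoords u - m • W) (y : E n) := by
    have e1 : ∀ᶠ z in 𝓝 (y : E n), z ∈ Subtype.val '' Ω :=
      (isOpen_ball.isOpenMap_subtype_val Ω hopen).mem_nhds ⟨y, hyΩ, rfl⟩
    have e2 : ∀ᶠ z in 𝓝 (y : E n), S < sinhDist α β ζ z :=
      (contDiffAt_sinhDist α β ζ y.2).continuousAt.eventually_const_lt hyS
    filter_upwards [e1, e2] with z hz hzS
    obtain ⟨w, hw, rfl⟩ := hz
    have h := hymax (show w ∈ K from ⟨subset_closure hw, hzS.le⟩)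
    have h' := (div_le_iff₀ (hWpos w hzS.le)).1 h
    simp only [Pi.sub_apply, Pi.smul_apply, smul_eq_mul, inCoords_coe, huy, sub_self]
    exact sub_nonpos.2 h'
  have hle := ballLaplacian_le_of_isLocalMax hfy (hcd y y.2 hyS.le) hmax
  have heq : -ballLaplacian (inCoords u) (y : E n) = lam * u y := hu.equation y hyΩ
  have hX0 : 0 < sinhDist α β ζ (y : E n) := by linarith
  have hLW := ballLaplacian_comp_sinhDist hβ hζ y.2 (contDiffAt_profile a hX0)
    ((eventually_gt_nhds hX0).mono fun X hX => hasDerivAt_profile a hX)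
    (hasDerivAt_profileDeriv a hX0)
  have hstrict := profile_strict_supersolution ha hyS.le
  rw [← hna, ← hLW] at hstrict
  have hneg : ballLaplacian W (y : E n) + lam * W y < 0 := by
    have : lam * W y ≤ a ^ 2 * W y := mul_le_mul_of_nonneg_right hlam (hWpos y hyK.2).le
    exact (add_le_add_right this _).trans_lt hstrict
  have : 0 ≤ m * (ballLaplacian W (y : E n) + lam * W y) := by
    rw [huy] at heq
    linarith
  linarith [mul_neg_of_pos_of_neg hm0 hneg]

/-- As the half-spaces around `ζ` shrink, the distance to them tends to infinity. -/
theorem tendsto_sinhDist_atTop {ζ : E n} (hζ : ‖ζ‖ = 1) (x : Hyp n) :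
    Tendsto (fun α : ℝ => sinhDist α (Real.sqrt (1 + α ^ 2)) ζ (x : E n)) atTop atTop := by
  have h0 := one_sub_normSq_pos x
  have hx1 : ‖(x : E n)‖ < 1 := mem_ball_zero_iff.1 x.2
  have hne : 0 < ‖(x : E n) - ζ‖ := by
    refine norm_pos_iff.2 (sub_ne_zero.2 fun h => ?_)
    rw [h, hζ] at hx1
    exact lt_irrefl _ hx1
  have hlow : Tendsto (fun α : ℝ => (α * ‖(x : E n) - ζ‖ ^ 2 + -2) / (1 - ‖(x : E n)‖ ^ 2))
      atTop atTop :=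
    (tendsto_atTop_add_const_right _ _
      (tendsto_id.atTop_mul_const (by positivity))).atTop_div_const h0
  refine tendsto_atTop_mono' _ ?_ hlow
  filter_upwards [eventually_ge_atTop 0] with α hα
  rw [sinhDist]
  refine div_le_div_of_nonneg_right ?_ h0.le
  have hβ1 : α ≤ Real.sqrt (1 + α ^ 2) := Real.le_sqrt_of_sq_le (by linarith)
  have hβ2 : Real.sqrt (1 + α ^ 2) ≤ α + 1 := Real.sqrt_le_iff.2 ⟨by linarith, by nlinarith⟩
  have hin : inner ℝ ζ (x : E n) ≤ 1 := by
    have := real_inner_le_norm ζ (x : E n)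
    rw [hζ, one_mul] at this
    linarith
  have hsq : ‖(x : E n) - ζ‖ ^ 2 = ‖(x : E n)‖ ^ 2 - 2 * inner ℝ ζ (x : E n) + 1 := by
    rw [norm_sub_sq_real, hζ, real_inner_comm]
    ring
  rw [hsq]
  have : (Real.sqrt (1 + α ^ 2) - α) * inner ℝ ζ (x : E n) ≤ 1 := by
    have h1 := mul_le_mul_of_nonneg_left hin (sub_nonneg.2 hβ1)
    linarith
  nlinarith

theorem IsLambdaHarmonic.nonpos_of_le {lam : ℝ} {Ω : Set (Hyp n)} {u : Hyp n → ℝ}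
    (hu : IsLambdaHarmonic lam Ω u) (hopen : IsOpen Ω) {M : ℝ} (hM : 0 ≤ M)
    (huM : ∀ x ∈ Ω, u x ≤ M) (hn : 2 ≤ n) (hlam : lam ≤ (((n : ℝ) - 1) / 2) ^ 2) {ζ : E n}
    (hζ : ‖ζ‖ = 1) (hΩ : ∀ ξ : E n, ‖ξ‖ = 1 → ξ ∈ closure (Subtype.val '' Ω) → ξ = ζ)
    {x : Hyp n} (hx : x ∈ Ω) : u x ≤ 0 := by
  have hn' : (2 : ℝ) ≤ n := by exact_mod_cast hn
  set a : ℝ := ((n : ℝ) - 1) / 2 with ha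
  have ha0 : 0 < a := by linarith
  have hX := tendsto_sinhDist_atTop hζ x
  have hlim := ((tendsto_profile_atTop ha0).comp hX).const_mul (M / profile a (a * (a + 1) + 1))
  rw [mul_zero] at hlim
  refine ge_of_tendsto hlim ?_
  filter_upwards [hX.eventually_ge_atTop (a * (a + 1) + 1)] with α hα
  refine hu.le_profile hopen hM huM ha0 (by linarith) hlam hζ hΩ ?_
    (Real.sq_sqrt (by positivity)) hx hα
  exact Real.lt_sqrt_of_sq_lt (by linarith)

end HypBall

theorem mainTheorem2 (n : ℕ) (hn : 2 ≤ n) (Ω : Set (HypBall.Hyp n))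
    (hopen : IsOpen Ω) (hconn : IsConnected Ω)
    (p : HypBall.IdealBoundary n)
    (hp : HypBall.asymptoticBoundary Ω = {HypBall.HypClosure.ideal p})
    (lam : ℝ) (hlam₀ : 0 ≤ lam) (hlam₁ : lam ≤ HypBall.lambdaOne n) :
    ¬ ∃ u : HypBall.Hyp n → ℝ,
      HypBall.IsLambdaHarmonic lam Ω u ∧ ∃ M : ℝ, ∀ x ∈ Ω, |u x| ≤ M := by
  rintro ⟨u, hu, M, hM⟩
  obtain ⟨x, hx, hux⟩ := hu.nontrivial
  obtain ⟨ζ, hζ, hΩ⟩ := HypBall.exists_unit_of_asymptoticBoundary_eq_singleton hn hp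
  have hlam := hlam₁.trans (HypBall.lambdaOne_le hn)
  have hM0 : 0 ≤ M := (abs_nonneg _).trans (hM x hx)
  have h1 : u x ≤ 0 :=
    hu.nonpos_of_le hopen hM0 (fun y hy => (le_abs_self _).trans (hM y hy)) hn hlam hζ hΩ hx
  have h2 : -u x ≤ 0 :=
    hu.neg.nonpos_of_le hopen hM0 (fun y hy => (neg_le_abs _).trans (hM y hy)) hn hlam hζ hΩ hx
  exact hux (by linarith)
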